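/- Let $n\ge 1$, let $S^{n-1}\subset\mathbb R^n$ be the unit sphere, let $m\in\mathbb N$, let $\mu_1,\dots,\mu_m$ be positive integers and put $k=\sum_{i=1}^m\mu_i$. Let $\mathcal A$ be the set of all $(v_1,\dots,v_m,u_1,\dots,u_k)\in (S^{n-1})^{m+k}$ such that the $v_i$ are pairwise distinct and the $u_j$ are pairwise distinct, with the topology inherited from the product of spheres; a point of $\mathcal A$ is identified with the pair of measures $\mu=\sum_{i=1}^m\mu_i\delta_{v_i}$, $\lambda=\sum_{j=1}^k\delta_{u_j}$. The pair is called weak Aleksandrov related if $\lambda(S^{n-1})=\mu(S^{n-1})\ge\mu(\omega)+\lambda(\omega^*)$ for every compact spherically convex $\omega\subset S^{n-1}$. Here $\omega$ is spherically convex if $\{tu: t\ge 0,\ u\in\omega\}$ is a nonempty convex set different from $\mathbb R^n$, and $\omega^*=\bigcap_{u\in\omega}\{v\in S^{n-1}: u\cdot v\le 0\}$. Let $\mathcal A_c\subset\mathcal A$ be the set of pairs that are weak Aleksandrov related and for which $\mu$ is not concentrated on a closed hemisphere $\{v\in S^{n-1}:u\cdot v\le 0\}$, $u\in S^{n-1}$.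 For a polytope $P\subset\mathbb R^n$ with the origin in its interior and $u\in S^{n-1}$, let $r_P(u)=\max\{a: au\in P\}\,u$. For $\omega\subset S^{n-1}$ let $\boldsymbol\alpha_P(\omega)$ be the set of all $v\in S^{n-1}$ that are outer unit normals of $P$ at some point of $r_P(\omega)$, i.e. $(y-x)\cdot v\le 0$ for some $x\in r_P(\omega)$ and all $y\in P$. A polytope solution for $(\mu,\lambda)$ is such a polytope $P$ whose vertices are exactly the points $r_P(v_i)$, $1\le i\le m$, and for which $\mu(\omega)=\lambda(\boldsymbol\alpha_P(\omega))$ for every Borel set $\omega\subset S^{n-1}$. Let $\mathbb F$ be the set of all $f:\{1,\dots,k\}\to\{1,\dots,m\}$ with $|f^{-1}(i)|=\mu_i$ for every $i$, and for $f\in\mathbb F$ let $A(f)=\sum_{j=1}^k\log(u_j\cdot v_{f(j)})\in[-\infty,0]$, where $\log t=-\infty$ for $t\le 0$. Then: 1. $\mathcal A_c$ is open in $\mathcal A$. 2. The set of pairs $(\mu,\lambda)\in\mathcal A$ for which a polytope solution exists is contained in $\mathcal A_c$, and it is an open and dense subset of $\mathcal A_c$. 3. The set of pairs $(\mu,\lambda)\in\mathcal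 A_c$ for which $A$ attains its maximum over $\mathbb F$ at exactly one $f\in\mathbb F$, with $A(f)>-\infty$, is also an open and dense subset of $\mathcal A_c$. -/

import Mathlib

open MeasureTheory Set
open scoped ENNReal

noncomputable section

namespace DiscreteGaussImage

/-- Euclidean `n`-space. -/
abbrev E (n : ℕ) := EuclideanSpace ℝ (Fin n)

/-- The unit sphere of Euclidean `n`-space. -/
abbrev Sph (n : ℕ) := Metric.sphere (0 : E n) 1

/-- The set `N(K, x)` of outer unit normals of `K` at `x`. -/
def normalCone {n : ℕ} (K : Set (E n)) (x : E n) : Set (Sph n) :=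
  {v | ∀ y ∈ K, inner ℝ (y - x) (v : E n) ≤ 0}

/-- The radial function `ρ_K(u) = max {a : a u ∈ K}`; the maximum exists when `K` is compact and
contains the origin. -/
def radialFun {n : ℕ} (K : Set (E n)) (u : Sph n) : ℝ :=
  sSup {a : ℝ | a • (u : E n) ∈ K}

/-- The radial map `r_K(u) = ρ_K(u) u`. -/
def radialMap {n : ℕ} (K : Set (E n)) (u : Sph n) : E n :=
  radialFun K u • (u : E n)

/-- The radial Gauss image of a set `ω` of directions. -/
def radialGaussImage {n : ℕ} (K : Set (E n)) (ω : Set (Sph n)) : Set (Sph n) :=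
  ⋃ x ∈ radialMap K '' ω, normalCone K x

/-- The Gauss image measure of `lam` via `K`, as a set function. It is applied below only to finite
sums of Dirac measures `lam`, whose value on an arbitrary set is the total mass of the atoms in
that set. -/
def gaussImageMeasure {n : ℕ} (lam : Measure (Sph n)) (K : Set (E n)) (ω : Set (Sph n)) : ℝ≥0∞ :=
  lam (radialGaussImage K ω)

/-- The cone generated by a set of directions. -/
def cone {n : ℕ} (ω : Set (Sph n)) : Set (E n) :=
  {x | ∃ t : ℝ, 0 ≤ t ∧ ∃ u ∈ ω, x = t • (u : E n)}

/-- Spherical convexity: the generated cone is nonempty, convex and not the whole space. -/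
def SphericallyConvex {n : ℕ} (ω : Set (Sph n)) : Prop :=
  (cone ω).Nonempty ∧ Convex ℝ (cone ω) ∧ cone ω ≠ univ

/-- The polar set of a set of directions. -/
def polarSet {n : ℕ} (ω : Set (Sph n)) : Set (Sph n) :=
  ⋂ u ∈ ω, {v | inner ℝ (u : E n) (v : E n) ≤ 0}

/-- The weak Aleksandrov relation. -/
def WeakAleksandrovRelated {n : ℕ} (mu lam : Measure (Sph n)) : Prop :=
  lam univ = mu univ ∧
    ∀ ω : Set (Sph n), IsCompact ω → SphericallyConvex ω → mu ω + lam (polarSet ω) ≤ mu univ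

/-- `mu` is concentrated on some closed hemisphere. -/
def ConcentratedOnClosedHemisphere {n : ℕ} (mu : Measure (Sph n)) : Prop :=
  ∃ u : Sph n, mu {v : Sph n | inner ℝ (u : E n) (v : E n) ≤ 0}ᶜ = 0

/-- The discrete measure `∑ i, w i δ_{x i}`. -/
def discreteMeasure {n m : ℕ} (w : Fin m → ℕ) (x : Fin m → Sph n) : Measure (Sph n) :=
  ∑ i, (w i : ℝ≥0∞) • Measure.dirac (x i)

/-- A polytope: the convex hull of a finite set of points. -/
def IsPolytope {n : ℕ} (P : Set (E n)) : Prop :=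
  ∃ F : Set (E n), F.Finite ∧ P = convexHull ℝ F

/-- The problem space for the weights `w 0, …, w (m - 1)`: pairs consisting of `m` distinct
directions `v i` and of `k = ∑ i, w i` distinct directions `u j`, with the topology inherited from
the product of `m + k` spheres. -/
abbrev ProblemSpace (n : ℕ) {m : ℕ} (w : Fin m → ℕ) :=
  {p : (Fin m → Sph n) × (Fin (∑ i, w i) → Sph n) //
    Function.Injective p.1 ∧ Function.Injective p.2}

namespace ProblemSpace

variable {n m : ℕ} {w : Fin m → ℕ}

/-- The directions `v i` of the point masses of `μ`. -/
def v (p : ProblemSpace n w) : Fin m → Sph n := p.1.1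

/-- The directions `u j` of the point masses of `λ`. -/
def u (p : ProblemSpace n w) : Fin (∑ i, w i) → Sph n := p.1.2

/-- The measure `μ = ∑ i, w i δ_{v i}`. -/
def mu (p : ProblemSpace n w) : Measure (Sph n) := discreteMeasure w (v p)

/-- The equal-weight measure `λ = ∑ j, δ_{u j}`. -/
def lam (p : ProblemSpace n w) : Measure (Sph n) := discreteMeasure (fun _ => 1) (u p)

end ProblemSpace

/-- There is a polytope `P` with the origin in its interior, whose vertices are exactly the points
`r_P(v i)`, such that `μ = λ(P, ·)` on Borel sets. -/
def HasPolytopeSolution {n m : ℕ} {w : Fin m → ℕ} (p : ProblemSpace n w) : Prop :=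
  ∃ P : Set (E n), IsPolytope P ∧ 0 ∈ interior P ∧
    P.extremePoints ℝ = range (fun i => radialMap P (ProblemSpace.v p i)) ∧
    ∀ ω : Set (Sph n), MeasurableSet ω →
      ProblemSpace.mu p ω = gaussImageMeasure (ProblemSpace.lam p) P ω

/-- The assignment functions of the weights `w` (all weights of `λ` being one). -/
def assignments {m : ℕ} (w : Fin m → ℕ) : Set (Fin (∑ i, w i) → Fin m) :=
  {f | ∀ i, (Finset.univ.filter (fun j => f j = i)).card = w i}

/-- The assignment functional `A(f) = ∑ j, log (u j · v (f j))` with values in the extended reals;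
the logarithm of a nonpositive number is `-∞`, since `ENNReal.ofReal` sends it to `0` and
`ENNReal.log 0 = ⊥`. -/
def assignmentFunctional {n m : ℕ} {w : Fin m → ℕ} (p : ProblemSpace n w)
    (f : Fin (∑ i, w i) → Fin m) : EReal :=
  ∑ j, ENNReal.log (ENNReal.ofReal
    (inner ℝ (ProblemSpace.u p j : E n) (ProblemSpace.v p (f j) : E n)))

/-- The assignment functional is maximized by exactly one assignment function, and its maximal
value is greater than `-∞`. -/
def UniquelyMaximized {n m : ℕ} {w : Fin m → ℕ} (p : ProblemSpace n w) : Prop :=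
  ∃ f ∈ assignments w, ⊥ < assignmentFunctional p f ∧
    ∀ g ∈ assignments w, g ≠ f → assignmentFunctional p g < assignmentFunctional p f

/-- The pairs that are weak Aleksandrov related and whose `μ` is not concentrated on a closed
hemisphere. -/
def admissibleSet (n : ℕ) {m : ℕ} (w : Fin m → ℕ) : Set (ProblemSpace n w) :=
  {p | WeakAleksandrovRelated (ProblemSpace.mu p) (ProblemSpace.lam p) ∧
    ¬ ConcentratedOnClosedHemisphere (ProblemSpace.mu p)}

/-- The pairs for which a polytope solution of the discrete Gauss image problem exists. -/
def solvableSet (n : ℕ) {m : ℕ} (w : Fin m → ℕ) : Set (ProblemSpace n w) :=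
  {p | HasPolytopeSolution p}

/-- The pairs for which the assignment functional has exactly one maximizer and a finite
maximum. -/
def uniquelyMaximizedSet (n : ℕ) {m : ℕ} (w : Fin m → ℕ) : Set (ProblemSpace n w) :=
  {p | UniquelyMaximized p}

end DiscreteGaussImage

end

/-! All three sets are described by inequalities between the numbers `u j · v l`. Write `f` for an
assignment and `r i > 0` for radii.

A polytope solution is the convex hull of points `r i • v i` for which each `u j` is maximized over
these points at the index `f j` only. So solvability means that the `v i` lie in no closed
hemisphere and that `r l (u j · v l) < r (f j) (u j · v (f j))` for all `l ≠ f j`, for some `f` and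
`r` (`hasPolytopeSolution_iff`). Admissibility means the same spanning condition together with some
`f` having all `u j · v (f j) > 0`; this is Hall's marriage theorem (`mem_admissibleSet_iff`). Both
conditions are open.

The radii are dual prices for the problem of maximizing `A`. An optimal assignment has prices
satisfying the weak inequalities (`exists_prices`). Strict prices exist exactly when the optimum is
unique (`exists_strict_prices`, `prod_lt_prod_of_strict_prices`). Hence, inside the admissible set,
unique maximization and solvability are the same condition.

For density, take an optimal assignment and its weak prices, and push each `u j` slightly towards `v
(f j)` while adjusting the radii. Every tie is then broken in favour of `f j`, because the points `r
i • v i` are distinct (`eventually_strict_prices`). -/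

namespace DiscreteGaussImage

open scoped Topology

/-! ### Duality for the assignment problem: potentials and prices -/

section Potential

variable {ι κ : Type*}

/-- The product of the weights of the edges of a path, listed from its end to its start. -/
def pathWeight (b : ι → ι → ℝ) : List ι → ℝ
  | [] => 1
  | [_] => 1
  | x :: y :: l => b y x * pathWeight b (y :: l)

theorem pathWeight_append (b : ι → ι → ℝ) (s t : List ι) (l : ι) :
    pathWeight b (s ++ l :: t) = pathWeight b (s ++ [l]) * pathWeight b (l :: t) := by
  induction s with
  | nil => simp [pathWeight]
  | cons x s ih =>
    cases s with
    | nil => simp [pathWeight]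
    | cons y s =>
      simp only [List.cons_append, pathWeight] at ih ⊢
      rw [ih, mul_assoc]

theorem pathWeight_nonneg (b : ι → ι → ℝ) (hb0 : ∀ i j, 0 ≤ b i j) (p : List ι) :
    0 ≤ pathWeight b p := by
  induction p with
  | nil => simp [pathWeight]
  | cons x p ih =>
    cases p with
    | nil => simp [pathWeight]
    | cons y p => exact mul_nonneg (hb0 _ _) ih

theorem prod_zipWith_eq_pathWeight (b : ι → ι → ℝ) (z x : ι) (l : List ι) :
    (List.zipWith b (l ++ [z]) (x :: l)).prod =
      pathWeight b (x :: l) * b z ((x :: l).getLast (List.cons_ne_nil x l)) := by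
  induction l generalizing x with
  | nil => simp [pathWeight]
  | cons y l ih =>
    simp only [List.cons_append, List.zipWith_cons_cons, List.prod_cons, pathWeight]
    rw [ih, mul_assoc, List.getLast_cons (List.cons_ne_nil y l)]

theorem map_formPerm_eq_rotate [DecidableEq ι] (c : List ι) (hc : c.Nodup) :
    c.map c.formPerm = c.rotate 1 := by
  apply List.ext_getElem
  · simp
  · intro i h1 h2
    simp only [List.getElem_map, List.getElem_rotate]
    rw [List.formPerm_apply_getElem _ hc]

variable [Fintype ι]

/-- A simple cycle is a permutation fixing all other vertices, and these contribute factors `b i i =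
1`. The inverse of `formPerm` appears because paths are listed from end to start. -/
theorem cycleWeight_le_one [DecidableEq ι] (b : ι → ι → ℝ) (hb1 : ∀ i, b i i = 1)
    (H : ∀ σ : Equiv.Perm ι, ∏ i, b i (σ i) ≤ 1) (x : ι) (l : List ι) (hl : (x :: l).Nodup) :
    pathWeight b (x :: l) * b x ((x :: l).getLast (List.cons_ne_nil x l)) ≤ 1 := by
  rw [← prod_zipWith_eq_pathWeight]
  have hrot : l ++ [x] = (x :: l).map (x :: l).formPerm := by
    rw [map_formPerm_eq_rotate _ hl]; simp
  rw [hrot, List.zipWith_map_left, List.zipWith_self,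
    ← List.prod_toFinset (fun y => b ((x :: l).formPerm y) y) hl]
  refine le_of_eq_of_le ?_ (H (x :: l).formPerm⁻¹)
  rw [← Equiv.prod_comp (x :: l).formPerm (fun i => b i ((x :: l).formPerm⁻¹ i))]
  simp only [Equiv.Perm.inv_def, Equiv.symm_apply_apply]
  refine Finset.prod_subset (Finset.subset_univ _) fun y _ hy => ?_
  rw [List.formPerm_apply_of_notMem (by simpa using hy), hb1]

/-- A weighted complete graph without cycles of weight greater than one has a multiplicative
potential. -/
theorem exists_potential (b : ι → ι → ℝ) (hb0 : ∀ i j, 0 ≤ b i j) (hb1 : ∀ i, b i i = 1)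
    (H : ∀ σ : Equiv.Perm ι, ∏ i, b i (σ i) ≤ 1) :
    ∃ T : ι → ℝ, (∀ i, 0 < T i) ∧ ∀ i l, T i * b i l ≤ T l := by
  classical
  -- The potential at `l` is the largest weight of a simple path ending at `l`; there are finitely
  -- many simple paths.
  have hmax : ∀ l : ι, ∃ q : List ι, (l :: q).Nodup ∧
      ∀ q', (l :: q').Nodup → pathWeight b (l :: q') ≤ pathWeight b (l :: q) := by
    intro l
    have hfin : {q : List ι | (l :: q).Nodup}.Finite := by
      have h : {p : List ι | p.Nodup}.Finite :=
        Set.finite_coe_iff.1 (Finite.of_fintype {p : List ι // p.Nodup})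
      exact h.preimage (f := fun q => l :: q) (fun a _ c _ hac => (List.cons.inj hac).2)
    obtain ⟨q, hq, hq'⟩ := Set.exists_max_image _ (fun q => pathWeight b (l :: q)) hfin
      ⟨[], by simp⟩
    exact ⟨q, hq, fun q' h => hq' q' h⟩
  choose q hq hmaxq using hmax
  have hpos : ∀ i, 0 < pathWeight b (i :: q i) := fun i =>
    lt_of_lt_of_le (by simp [pathWeight]) (hmaxq i [] (by simp))
  refine ⟨fun i => pathWeight b (i :: q i), hpos, fun i l => ?_⟩
  rcases eq_or_ne i l with rfl | hil
  · rw [hb1, mul_one]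
  -- Extend the best path to `i` by the edge from `i` to `l`. If `l` was already visited, this
  -- closes a cycle of weight at most one, and dropping it leaves a simple path ending at `l`.
  by_cases hl : l ∈ i :: q i
  · obtain ⟨s, t, hst⟩ := List.append_of_mem hl
    have hnd : (s ++ l :: t).Nodup := hst ▸ hq i
    cases s with
    | nil => exact absurd (List.cons.inj hst).1 hil
    | cons y s =>
      obtain rfl : i = y := (List.cons.inj hst).1
      have hcyc := cycleWeight_le_one b hb1 H i (s ++ [l]) (by
        refine hnd.sublist ?_
        simp only [List.cons_append]
        refine List.Sublist.cons_cons _ (List.Sublist.append_left ?_ _)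
        simp)
      have hlast : (i :: (s ++ [l])).getLast (List.cons_ne_nil _ _) = l := by simp
      rw [hlast] at hcyc
      have hlt : (l :: t).Nodup := hnd.sublist (List.sublist_append_right _ _)
      have ht := hmaxq l t hlt
      have h0 := pathWeight_nonneg b hb0 (l :: t)
      calc pathWeight b (i :: q i) * b i l
          = (pathWeight b (i :: (s ++ [l])) * b i l) * pathWeight b (l :: t) := by
            rw [hst, pathWeight_append, List.cons_append]; ring
        _ ≤ 1 * pathWeight b (l :: t) := mul_le_mul_of_nonneg_right hcyc h0
        _ ≤ _ := by rwa [one_mul]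
  · have := hmaxq l (i :: q i) (List.nodup_cons.2 ⟨hl, hq i⟩)
    rw [pathWeight] at this
    linarith

/-- Complementary slackness for an optimal assignment: prices `r` for which each `j` is assigned
to an optimal column. -/
theorem exists_prices (b : ι → κ → ℝ) (hb0 : ∀ j l, 0 ≤ b j l) (f : ι → κ)
    (hf : Function.Surjective f) (hpos : ∀ j, 0 < b j (f j))
    (H : ∀ σ : Equiv.Perm ι, ∏ j, b j (f (σ j)) ≤ ∏ j, b j (f j)) :
    ∃ r : κ → ℝ, (∀ l, 0 < r l) ∧ ∀ j l, r l * b j l ≤ r (f j) * b j (f j) := by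
  -- The edge from `j` to `j'` carries the gain from moving `j` to the column of `j'`; optimality of
  -- `f` bounds the product of gains over any permutation by one.
  obtain ⟨T, hT, hTb⟩ := exists_potential (fun j j' => b j (f j') / b j (f j))
    (fun j j' => div_nonneg (hb0 _ _) (hb0 _ _)) (fun j => div_self (hpos j).ne') (fun σ => by
      rw [Finset.prod_div_distrib]
      exact (div_le_one (Finset.prod_pos fun j _ => hpos j)).2 (H σ))
  have hle : ∀ j j', f j = f j' → T j ≤ T j' := fun j j' h => by
    have := hTb j j'
    rwa [← h, div_self (hpos j).ne', mul_one] at this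
  have hg := Function.rightInverse_surjInv hf
  -- `T` is constant on the fibres of `f`, so its reciprocal descends to the columns.
  refine ⟨fun l => (T (Function.surjInv hf l))⁻¹, fun l => inv_pos.2 (hT _), fun j l => ?_⟩
  have hj : T (Function.surjInv hf (f j)) = T j :=
    le_antisymm (hle _ _ (hg _)) (hle _ _ (hg _).symm)
  have h := hTb j (Function.surjInv hf l)
  rw [hg l, ← mul_div_assoc, div_le_iff₀ (hpos j)] at h
  simp only [hj]
  rw [inv_mul_le_iff₀ (hT _), ← mul_assoc, mul_comm (T (Function.surjInv hf l)), mul_assoc,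
    le_inv_mul_iff₀ (hT _)]
  exact h

/-- If an assignment is the only optimal one, then the prices may be chosen so that all
inequalities are strict. -/
theorem exists_strict_prices (b : ι → κ → ℝ) (hb0 : ∀ j l, 0 ≤ b j l) (f : ι → κ)
    (hf : Function.Surjective f) (hpos : ∀ j, 0 < b j (f j))
    (H : ∀ σ : Equiv.Perm ι, f ∘ σ ≠ f → ∏ j, b j (f (σ j)) < ∏ j, b j (f j)) :
    ∃ r : κ → ℝ, (∀ l, 0 < r l) ∧ ∀ j l, l ≠ f j → r l * b j l < r (f j) * b j (f j) := by
  classical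
  -- Finitely many strict inequalities leave room to inflate every entry by a common factor `1 + η`.
  obtain ⟨η, hη, hηpos⟩ : ∃ η : ℝ, (∀ σ : Equiv.Perm ι, f ∘ σ ≠ f →
      (1 + η) ^ Fintype.card ι * ∏ j, b j (f (σ j)) < ∏ j, b j (f j)) ∧ 0 < η := by
    have hev : ∀ᶠ η : ℝ in nhds 0, ∀ σ : Equiv.Perm ι, f ∘ σ ≠ f →
        (1 + η) ^ Fintype.card ι * ∏ j, b j (f (σ j)) < ∏ j, b j (f j) := by
      refine Filter.eventually_all.2 fun σ => ?_
      by_cases hσ : f ∘ σ ≠ f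
      · have hc : Continuous fun η : ℝ => (1 + η) ^ Fintype.card ι * ∏ j, b j (f (σ j)) := by
          fun_prop
        filter_upwards [hc.continuousAt.eventually_lt continuousAt_const
          (by simpa using H σ hσ)] with η h _ using h
      · exact Filter.Eventually.of_forall fun _ h => absurd h hσ
    exact ((hev.filter_mono nhdsWithin_le_nhds).and
      (self_mem_nhdsWithin : Ioi (0 : ℝ) ∈ nhdsWithin 0 (Ioi 0))).exists
  -- `f` stays optimal after all entries off `f` are inflated. Weak prices for the inflated matrix
  -- are strict for the original one; zero entries are treated separately, since inflation does not
  -- change them.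
  obtain ⟨r, hr, hrb⟩ := exists_prices (fun j l => if l = f j then b j l else (1 + η) * b j l)
    (fun j l => by
      split_ifs
      · exact hb0 j l
      · exact mul_nonneg (by linarith) (hb0 j l)) f hf (fun j => by simpa using hpos j)
    (fun σ => by
      by_cases hσ : f ∘ σ = f
      · have : ∀ j, f (σ j) = f j := congrFun hσ
        simp [this]
      · simp only [if_true]
        refine le_trans ?_ (hη σ hσ).le
        rw [Fintype.card, ← Finset.prod_const (s := Finset.univ), ← Finset.prod_mul_distrib]
        refine Finset.prod_le_prod (fun j _ => ?_) fun j _ => ?_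
        · split_ifs
          · exact hb0 _ _
          · exact mul_nonneg (by linarith) (hb0 _ _)
        · split_ifs
          · nlinarith [hb0 j (f (σ j))]
          · exact le_rfl)
  refine ⟨r, hr, fun j l hl => ?_⟩
  have h := hrb j l
  simp only [if_neg hl, if_true] at h
  rcases (hb0 j l).eq_or_lt with h0 | h0
  · rw [← h0, mul_zero]
    exact mul_pos (hr _) (hpos j)
  · refine lt_of_lt_of_le ?_ h
    exact mul_lt_mul_of_pos_left (by nlinarith) (hr l)

/-- With strict prices, an assignment is the only optimal one among those with the same
column counts. -/
theorem prod_lt_prod_of_strict_prices [Fintype κ] [DecidableEq κ] (b : ι → κ → ℝ)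
    (hb0 : ∀ j l, 0 ≤ b j l) (f g : ι → κ)
    (hfg : ∀ i, (Finset.univ.filter fun j => f j = i).card =
      (Finset.univ.filter fun j => g j = i).card)
    (hne : g ≠ f) (hpos : ∀ j, 0 < b j (f j)) (r : κ → ℝ) (hr : ∀ l, 0 < r l)
    (hrb : ∀ j l, l ≠ f j → r l * b j l < r (f j) * b j (f j)) :
    ∏ j, b j (g j) < ∏ j, b j (f j) := by
  have hf0 : 0 < ∏ j, b j (f j) := Finset.prod_pos fun j _ => hpos j
  by_cases hz : ∃ j, b j (g j) = 0
  · obtain ⟨j, hj⟩ := hz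
    rwa [Finset.prod_eq_zero (Finset.mem_univ j) hj]
  push Not at hz
  have hg0 : ∀ j, 0 < b j (g j) := fun j => (hb0 _ _).lt_of_ne' (hz j)
  -- The product of prices along an assignment depends only on the column counts.
  have hprod : ∏ j, r (g j) = ∏ j, r (f j) := by
    have key : ∀ h : ι → κ, ∏ j, r (h j) =
        ∏ i, r i ^ (Finset.univ.filter fun j => h j = i).card := fun h => by
      rw [← Finset.prod_fiberwise Finset.univ h]
      refine Finset.prod_congr rfl fun i _ => ?_
      rw [← Finset.prod_const]
      exact Finset.prod_congr rfl fun j hj => by rw [(Finset.mem_filter.1 hj).2]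
    rw [key, key]
    simp only [hfg]
  have hlt : ∏ j, r (g j) * b j (g j) < ∏ j, r (f j) * b j (f j) := by
    refine Finset.prod_lt_prod (fun j _ => mul_pos (hr _) (hg0 j)) (fun j _ => ?_) ?_
    · by_cases h : g j = f j
      · rw [h]
      · exact (hrb j _ h).le
    · obtain ⟨j, hj⟩ := Function.ne_iff.1 hne
      exact ⟨j, Finset.mem_univ j, hrb j _ hj⟩
  rw [Finset.prod_mul_distrib, Finset.prod_mul_distrib, hprod] at hlt
  exact lt_of_mul_lt_mul_left hlt (Finset.prod_nonneg fun j _ => (hr _).le)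

end Potential

/-! ### Discrete measures and the hemisphere condition -/

section Measures

variable {n m : ℕ}

open Classical in
theorem discreteMeasure_apply (w : Fin m → ℕ) (x : Fin m → Sph n) (A : Set (Sph n)) :
    discreteMeasure w x A = ((∑ i with x i ∈ A, w i : ℕ) : ℝ≥0∞) := by
  simp only [discreteMeasure, Measure.finsetSum_apply, Measure.smul_apply, Measure.dirac_apply,
    smul_eq_mul, Finset.sum_filter, Nat.cast_sum, Set.indicator_apply, Pi.one_apply]
  refine Finset.sum_congr rfl fun i _ => ?_
  split_ifs <;> simp

/-- The directions `v i` do not all lie in one closed hemisphere. -/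
def PositivelySpanning (v : Fin m → Sph n) : Prop :=
  ∀ u : Sph n, ∃ i, 0 < inner ℝ (u : E n) (v i : E n)

theorem not_concentrated_iff {w : Fin m → ℕ} (hw : ∀ i, 0 < w i) (v : Fin m → Sph n) :
    ¬ ConcentratedOnClosedHemisphere (discreteMeasure w v) ↔ PositivelySpanning v := by
  classical
  simp only [ConcentratedOnClosedHemisphere, PositivelySpanning, not_exists]
  refine forall_congr' fun u => ?_
  rw [discreteMeasure_apply, Nat.cast_eq_zero, Finset.sum_eq_zero_iff]
  simp only [Finset.mem_filter, Finset.mem_univ, true_and, mem_compl_iff, mem_ofPred_eq, not_le]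
  push Not
  exact ⟨fun ⟨i, hi, _⟩ => ⟨i, hi⟩, fun ⟨i, hi⟩ => ⟨i, hi, (hw i).ne'⟩⟩

/-- The complement is the projection of a closed set along the compact sphere of possible `u`. -/
theorem isOpen_positivelySpanning : IsOpen {v : Fin m → Sph n | PositivelySpanning v} := by
  have hclosed : IsClosed {q : Sph n × (Fin m → Sph n) |
      ∀ i, inner ℝ (q.1 : E n) (q.2 i : E n) ≤ 0} := by
    rw [ofPred_forall]
    refine isClosed_iInter fun i => isClosed_le ?_ continuous_const
    fun_prop
  have h := (isClosedMap_snd_of_compactSpace _ hclosed).isOpen_compl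
  convert h using 1
  ext v
  simp only [PositivelySpanning, mem_ofPred_eq, mem_compl_iff, mem_image, Prod.exists,
    exists_eq_right, not_exists, not_forall, not_le]

end Measures

/-! ### Convex hulls and radial functions -/

section Geometry

variable {n m : ℕ}

theorem norm_coe_sph (u : Sph n) : ‖(u : E n)‖ = 1 := by
  simp

theorem eq_of_smul_eq_smul {a b : ℝ} {s t : Sph n} (ha : 0 ≤ a) (hb : 0 < b)
    (h : a • (s : E n) = b • (t : E n)) : s = t := by
  have hab : a = b := by
    have := congrArg norm h
    rwa [norm_smul, norm_smul, norm_coe_sph, norm_coe_sph, mul_one, mul_one,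
      Real.norm_of_nonneg ha, Real.norm_of_nonneg hb.le] at this
  subst hab
  exact Subtype.ext (smul_right_injective (E n) hb.ne' h)

theorem inner_le_of_mem_convexHull {ι : Type*} {x : ι → E n} {z y : E n} {M : ℝ}
    (hM : ∀ i, inner ℝ z (x i) ≤ M) (hy : y ∈ convexHull ℝ (range x)) : inner ℝ z y ≤ M := by
  have hc : Convex ℝ {y : E n | inner ℝ z y ≤ M} :=
    convex_halfSpace_le (innerₛₗ ℝ z).isLinear M
  exact convexHull_min (by rintro _ ⟨i, rfl⟩; exact hM i) hc hy

/-- A point of a convex hull at which a linear functional attains its maximum `M` is the only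
generator with value `M`. -/
theorem eq_or_inner_lt_of_mem_convexHull {ι : Type*} {x : ι → E n} {z y : E n} {i : ι}
    (hM : ∀ l, l ≠ i → inner ℝ z (x l) < inner ℝ z (x i)) (hy : y ∈ convexHull ℝ (range x)) :
    y = x i ∨ inner ℝ z y < inner ℝ z (x i) := by
  have hc : Convex ℝ {y : E n | y = x i ∨ inner ℝ z y < inner ℝ z (x i)} := by
    rw [convex_iff_forall_pos]
    intro a ha b hb s t hs ht hst
    have hexp : inner ℝ z (s • a + t • b) = s * inner ℝ z a + t * inner ℝ z b := by
      rw [inner_add_right, inner_smul_right, inner_smul_right]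
    have hsi : inner ℝ z (x i) = s * inner ℝ z (x i) + t * inner ℝ z (x i) := by
      rw [← add_mul, hst, one_mul]
    simp only [mem_ofPred_eq] at ha hb ⊢
    rcases ha with rfl | ha
    · rcases hb with rfl | hb
      · left; rw [← add_smul, hst, one_smul]
      · right; rw [hexp]; nlinarith
    · right
      have hb' : inner ℝ z b ≤ inner ℝ z (x i) := by
        rcases hb with rfl | hb
        · exact le_rfl
        · exact hb.le
      rw [hexp]; nlinarith
  refine convexHull_min ?_ hc hy
  rintro _ ⟨l, rfl⟩
  by_cases h : l = i
  · left; rw [h]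
  · right; exact hM l h

theorem bddAbove_smul_mem {K : Set (E n)} (hK : IsCompact K) (s : Sph n) :
    BddAbove {a : ℝ | a • (s : E n) ∈ K} := by
  obtain ⟨R, hR⟩ := hK.isBounded.exists_norm_le
  refine ⟨R, fun a ha => ?_⟩
  have := hR _ ha
  rw [norm_smul, norm_coe_sph, mul_one] at this
  exact (le_abs_self a).trans this

theorem radialMap_mem {K : Set (E n)} (hK : IsCompact K) (h0 : (0 : E n) ∈ K) (s : Sph n) :
    radialMap K s ∈ K ∧ 0 ≤ radialFun K s := by
  have hbdd := bddAbove_smul_mem hK s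
  have h0' : (0 : ℝ) ∈ {a : ℝ | a • (s : E n) ∈ K} := by simpa using h0
  have hcl : IsClosed {a : ℝ | a • (s : E n) ∈ K} :=
    hK.isClosed.preimage (by fun_prop)
  exact ⟨hcl.csSup_mem ⟨0, h0'⟩ hbdd, le_csSup hbdd h0'⟩

theorem radialFun_pos {K : Set (E n)} (hK : IsCompact K) (h0 : (0 : E n) ∈ interior K)
    (s : Sph n) : 0 < radialFun K s := by
  have hbdd := bddAbove_smul_mem hK s
  have hev : ∀ᶠ a : ℝ in 𝓝 0, a • (s : E n) ∈ K := by
    have hc : ContinuousAt (fun a : ℝ => a • (s : E n)) 0 := by fun_prop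
    refine hc.eventually_mem ?_
    rw [zero_smul]
    exact mem_interior_iff_mem_nhds.1 h0
  obtain ⟨a, ha, ha0⟩ := ((hev.filter_mono nhdsWithin_le_nhds).and
    (self_mem_nhdsWithin : Ioi (0 : ℝ) ∈ 𝓝[>] 0)).exists
  exact lt_of_lt_of_le ha0 (le_csSup hbdd ha)

/-- The support function of the hull is continuous and positive on the sphere, so it has a positive
minimum `δ`. By Hahn–Banach separation the ball of radius `δ` lies in the hull. -/
theorem zero_mem_interior_convexHull (hn : 1 ≤ n) (x : Fin m → E n)
    (hx : ∀ u : Sph n, ∃ i, 0 < inner ℝ (u : E n) (x i)) :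
    (0 : E n) ∈ interior (convexHull ℝ (range x)) := by
  have hne : Nonempty (Sph n) := by
    have : Nonempty (Fin n) := ⟨⟨0, hn⟩⟩
    obtain ⟨u, hu⟩ := (NormedSpace.sphere_nonempty (E := E n) (x := 0) (r := 1)).2 zero_le_one
    exact ⟨⟨u, hu⟩⟩
  have hm : (Finset.univ : Finset (Fin m)).Nonempty := by
    obtain ⟨i, _⟩ := hx hne.some
    exact ⟨i, Finset.mem_univ i⟩
  have hcont : Continuous fun u : Sph n =>
      Finset.univ.sup' hm fun i => inner ℝ (u : E n) (x i) := by
    refine Continuous.finset_sup'_apply hm fun i _ => by fun_prop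
  obtain ⟨u₀, -, hu₀⟩ := isCompact_univ.exists_isMinOn ⟨hne.some, mem_univ _⟩ hcont.continuousOn
  set δ := Finset.univ.sup' hm fun i => inner ℝ (u₀ : E n) (x i) with hδ
  have hδ0 : 0 < δ := by
    obtain ⟨i, hi⟩ := hx u₀
    exact hi.trans_le (Finset.le_sup' (fun i => inner ℝ (u₀ : E n) (x i)) (Finset.mem_univ i))
  have hδle : ∀ u : Sph n, ∃ i, δ ≤ inner ℝ (u : E n) (x i) := fun u => by
    have := hu₀ (mem_univ u)
    obtain ⟨i, -, hi⟩ := Finset.exists_mem_eq_sup' hm fun i => inner ℝ (u : E n) (x i)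
    exact ⟨i, hi ▸ this⟩
  refine mem_interior.2 ⟨Metric.ball 0 δ, fun z hz => ?_, Metric.isOpen_ball,
    Metric.mem_ball_self hδ0⟩
  by_contra hzP
  obtain ⟨g, s, hg1, hg2⟩ := geometric_hahn_banach_closed_point (convex_convexHull ℝ (range x))
    ((Set.finite_range x).isCompact_convexHull ℝ).isClosed hzP
  obtain ⟨y, rfl⟩ := (InnerProductSpace.toDual ℝ (E n)).surjective g
  simp only [InnerProductSpace.toDual_apply_apply] at hg1 hg2
  have hy : y ≠ 0 := by
    rintro rfl
    have := hg1 _ (subset_convexHull ℝ _ (mem_range_self hm.choose))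
    simp only [inner_zero_left] at this hg2
    linarith
  have hy0 : 0 < ‖y‖ := norm_pos_iff.2 hy
  obtain ⟨i, hi⟩ := hδle ⟨‖y‖⁻¹ • y, by simp [norm_smul, hy0.ne']⟩
  have hi' := hg1 _ (subset_convexHull ℝ _ (mem_range_self i))
  simp only [real_inner_smul_left] at hi
  rw [le_inv_mul_iff₀ hy0] at hi
  have h1 := real_inner_le_norm y z
  have h2 : ‖z‖ < δ := by simpa using hz
  nlinarith

end Geometry

/-! ### Polytope solutions as strict inequalities -/

section Solutions

variable {n m : ℕ} {w : Fin m → ℕ}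

theorem sum_eq_card_filter {f : Fin (∑ i, w i) → Fin m} (hf : f ∈ assignments w)
    (A : Set (Fin m)) [DecidablePred (· ∈ A)] :
    ∑ i with i ∈ A, w i = (Finset.univ.filter fun j => f j ∈ A).card := by
  rw [Finset.card_eq_sum_card_fiberwise (f := f) (t := Finset.univ.filter (· ∈ A))
    (fun j hj => by simpa using hj)]
  refine Finset.sum_congr rfl fun i hi => ?_
  rw [← hf i, Finset.filter_filter]
  congr 1
  ext j
  simp only [Finset.mem_filter, Finset.mem_univ, true_and] at hi ⊢
  exact ⟨fun h => ⟨h ▸ hi, h⟩, fun h => h.2⟩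

theorem surjective_of_mem_assignments (hw : ∀ i, 0 < w i) {f : Fin (∑ i, w i) → Fin m}
    (hf : f ∈ assignments w) : Function.Surjective f := fun i => by
  have h := hw i
  rw [← hf i, Finset.card_pos] at h
  obtain ⟨j, hj⟩ := h
  exact ⟨j, (Finset.mem_filter.1 hj).2⟩

/-- The points `r i • v i` are such that `u j` is an outer normal at the point with index `f j`
and at no other one. -/
def StrictlySeparates (p : ProblemSpace n w) (f : Fin (∑ i, w i) → Fin m) (r : Fin m → ℝ) :
    Prop :=
  ∀ j l, l ≠ f j → r l * inner ℝ (p.u j : E n) (p.v l : E n) <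
    r (f j) * inner ℝ (p.u j : E n) (p.v (f j) : E n)

theorem StrictlySeparates.inner_pos {p : ProblemSpace n w} {f : Fin (∑ i, w i) → Fin m}
    {r : Fin m → ℝ} (h : StrictlySeparates p f r) (hr : ∀ i, 0 < r i)
    (hp : PositivelySpanning p.v) (j) : 0 < inner ℝ (p.u j : E n) (p.v (f j) : E n) := by
  obtain ⟨l, hl⟩ := hp (p.u j)
  by_cases hlf : l = f j
  · rwa [← hlf]
  · exact pos_of_mul_pos_right ((mul_pos (hr l) hl).trans (h j l hlf)) (hr _).le

/-- On the hull of the points `r i • v i`, the functional `u j` exposes the point with index `f j`.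
Since `f` is onto, every generator is a vertex, and each `u j` is a normal at precisely one boundary
point in the image of the radial map. -/
theorem hasPolytopeSolution_of_strictlySeparates (hn : 1 ≤ n) (hw : ∀ i, 0 < w i)
    {p : ProblemSpace n w} (hp : PositivelySpanning p.v) {f : Fin (∑ i, w i) → Fin m}
    (hf : f ∈ assignments w) {r : Fin m → ℝ} (hr : ∀ i, 0 < r i)
    (h : StrictlySeparates p f r) : HasPolytopeSolution p := by
  classical
  set x : Fin m → E n := fun i => r i • (p.v i : E n) with hx
  set P : Set (E n) := convexHull ℝ (range x) with hP
  have hPc : IsCompact P := (Set.finite_range x).isCompact_convexHull ℝ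
  have h0 : (0 : E n) ∈ interior P := zero_mem_interior_convexHull hn x fun u => by
    obtain ⟨i, hi⟩ := hp u
    exact ⟨i, by simpa only [hx, inner_smul_right] using mul_pos (hr i) hi⟩
  have hsep : ∀ j l, l ≠ f j →
      inner ℝ (p.u j : E n) (x l) < inner ℝ (p.u j : E n) (x (f j)) := fun j l hl => by
    simpa only [hx, inner_smul_right] using h j l hl
  have hmem : ∀ i, x i ∈ P := fun i => subset_convexHull ℝ _ (mem_range_self i)
  have hmax : ∀ j, ∀ y ∈ P, inner ℝ (p.u j : E n) y ≤ inner ℝ (p.u j : E n) (x (f j)) :=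
    fun j y hy => by
      rcases eq_or_inner_lt_of_mem_convexHull (hsep j) hy with rfl | hlt
      · exact le_rfl
      · exact hlt.le
  have hrad : ∀ i, radialMap P (p.v i) = x i := fun i => by
    obtain ⟨j, rfl⟩ := surjective_of_mem_assignments hw hf i
    have hgr : IsGreatest {a : ℝ | a • (p.v (f j) : E n) ∈ P} (r (f j)) := by
      refine ⟨hmem (f j), fun a ha => ?_⟩
      have := hmax j _ ha
      simp only [hx, inner_smul_right] at this
      exact le_of_mul_le_mul_right this (h.inner_pos hr hp j)
    simp only [radialMap, radialFun, hgr.csSup_eq, hx]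
  refine ⟨P, ⟨range x, Set.finite_range x, rfl⟩, h0, ?_, fun ω _ => ?_⟩
  · simp only [hrad]
    refine Subset.antisymm extremePoints_convexHull_subset ?_
    rintro _ ⟨i, rfl⟩
    obtain ⟨j, rfl⟩ := surjective_of_mem_assignments hw hf i
    refine exposedPoints_subset_extremePoints ⟨hmem _, innerSL ℝ (p.u j : E n),
      fun y hy => ⟨hmax j y hy, fun hle => ?_⟩⟩
    exact (eq_or_inner_lt_of_mem_convexHull (hsep j) hy).resolve_right hle.not_gt
  · have hiff : ∀ j, p.u j ∈ radialGaussImage P ω ↔ p.v (f j) ∈ ω := fun j => by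
      simp only [radialGaussImage, mem_iUnion, mem_image, exists_prop]
      constructor
      · rintro ⟨_, ⟨s, hs, rfl⟩, hN⟩
        obtain ⟨hsP, hs0⟩ := radialMap_mem hPc (interior_subset h0) s
        have hle := hN _ (hmem (f j))
        rw [inner_sub_left, sub_nonpos, real_inner_comm, real_inner_comm _ (radialMap P s)] at hle
        have heq := (eq_or_inner_lt_of_mem_convexHull (hsep j) hsP).resolve_right hle.not_gt
        rwa [← eq_of_smul_eq_smul hs0 (hr (f j)) heq]
      · refine fun hv => ⟨_, ⟨_, hv, rfl⟩, fun y hy => ?_⟩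
        rw [hrad, inner_sub_left, sub_nonpos, real_inner_comm, real_inner_comm _ (x (f j))]
        exact hmax j y hy
    rw [gaussImageMeasure, ProblemSpace.mu, ProblemSpace.lam, discreteMeasure_apply,
      discreteMeasure_apply]
    simp only [hiff]
    rw [Finset.sum_const, smul_eq_mul, mul_one]
    have := sum_eq_card_filter hf (p.v ⁻¹' ω)
    simp only [mem_preimage] at this
    rw [this]

/-- A counting argument gives strictness: the normal cone at vertex `i` contains exactly `w i` of
the `u j`, every `u j` lies in some such cone, and there are only `∑ i, w i` of them. Hence no `u j`
lies in two cones. -/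
theorem HasPolytopeSolution.positivelySpanning_and_exists {p : ProblemSpace n w}
    (hp : HasPolytopeSolution p) : PositivelySpanning p.v ∧
      ∃ f ∈ assignments w, ∃ r : Fin m → ℝ, (∀ i, 0 < r i) ∧ StrictlySeparates p f r := by
  classical
  obtain ⟨P, ⟨F, hF, rfl⟩, h0, hext, hmeas⟩ := hp
  set P := convexHull ℝ F
  have hPc : IsCompact P := hF.isCompact_convexHull ℝ
  set x : Fin m → E n := fun i => radialMap P (p.v i) with hx
  have hPx : P = convexHull ℝ (range x) := by
    rw [← closure_convexHull_extremePoints hPc (convex_convexHull ℝ F), hext]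
    exact ((Set.finite_range x).isCompact_convexHull ℝ).isClosed.closure_eq
  have hr : ∀ i, 0 < radialFun P (p.v i) := fun i => radialFun_pos hPc h0 _
  have hne : Nonempty (Fin m) := by
    by_contra hm
    rw [not_nonempty_iff] at hm
    rw [hPx, range_eq_empty, convexHull_empty, interior_empty] at h0
    exact h0
  have hspan : PositivelySpanning p.v := fun u => by
    by_contra hu
    push Not at hu
    have hle : ∀ y ∈ P, inner ℝ (u : E n) y ≤ 0 := fun y hy => by
      rw [hPx] at hy
      refine inner_le_of_mem_convexHull (fun i => ?_) hy
      simp only [hx, radialMap, inner_smul_right]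
      exact mul_nonpos_of_nonneg_of_nonpos (hr i).le (hu i)
    have h1 := hle _ (radialMap_mem hPc (interior_subset h0) u).1
    rw [radialMap, inner_smul_right, real_inner_self_eq_norm_sq, norm_coe_sph] at h1
    linarith [radialFun_pos hPc h0 u]
  refine ⟨hspan, ?_⟩
  have hN : ∀ i u, u ∈ normalCone P (x i) ↔
      ∀ l, inner ℝ (u : E n) (x l) ≤ inner ℝ (u : E n) (x i) := fun i u => by
    constructor
    · intro h l
      have := h (x l) (hPx ▸ subset_convexHull ℝ _ (mem_range_self l))
      rwa [inner_sub_left, sub_nonpos, real_inner_comm, real_inner_comm _ (x i)] at this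
    · intro h y hy
      rw [inner_sub_left, sub_nonpos, real_inner_comm, real_inner_comm _ (x i)]
      exact inner_le_of_mem_convexHull h (hPx ▸ hy)
  have hcard : ∀ i, (Finset.univ.filter fun j => p.u j ∈ normalCone P (x i)).card = w i :=
    fun i => by
      -- Testing the measure equation on the singleton of `v i` counts the normals at that vertex.
      have := hmeas {p.v i} (measurableSet_singleton _)
      rw [gaussImageMeasure, ProblemSpace.mu, ProblemSpace.lam, discreteMeasure_apply,
        discreteMeasure_apply, Nat.cast_inj] at this
      simp only [radialGaussImage, image_singleton, mem_singleton_iff, iUnion_iUnion_eq_left,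
        p.2.1.eq_iff, ProblemSpace.v] at this
      rw [Finset.sum_filter, Finset.sum_ite_eq'] at this
      simpa [hx, ProblemSpace.v] using this.symm
  have hex : ∀ j, ∃ i, p.u j ∈ normalCone P (x i) := fun j => by
    obtain ⟨i, hi⟩ := Finite.exists_max fun i => inner ℝ (p.u j : E n) (x i)
    exact ⟨i, (hN i _).2 hi⟩
  choose f hf using hex
  have hsub : ∀ i, (Finset.univ.filter fun j => f j = i) ⊆
      Finset.univ.filter fun j => p.u j ∈ normalCone P (x i) := fun i j hj => by
    rw [Finset.mem_filter] at hj ⊢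
    exact ⟨hj.1, hj.2 ▸ hf j⟩
  have hsum : ∑ i, (Finset.univ.filter fun j => f j = i).card = ∑ i, w i := by
    rw [← Finset.card_eq_sum_card_fiberwise (fun j _ => Finset.mem_univ _)]
    simp
  have hfw : f ∈ assignments w := by
    have := (Finset.sum_eq_sum_iff_of_le
      (fun i _ => (hcard i) ▸ Finset.card_le_card (hsub i))).1 hsum
    exact fun i => this i (Finset.mem_univ i)
  refine ⟨f, hfw, fun i => radialFun P (p.v i), hr, fun j l hl => ?_⟩
  have hnot : p.u j ∉ normalCone P (x l) := fun hmem => by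
    have heq := Finset.eq_of_subset_of_card_le (hsub l) (by rw [hcard, hfw l])
    have : j ∈ Finset.univ.filter fun j => f j = l := by
      rw [heq]; simpa using hmem
    exact hl (Finset.mem_filter.1 this).2.symm
  rw [hN] at hnot
  push Not at hnot
  obtain ⟨i, hi⟩ := hnot
  have := lt_of_lt_of_le hi ((hN _ _).1 (hf j) i)
  simpa only [hx, radialMap, inner_smul_right] using this

theorem hasPolytopeSolution_iff (hn : 1 ≤ n) (hw : ∀ i, 0 < w i) (p : ProblemSpace n w) :
    HasPolytopeSolution p ↔ PositivelySpanning p.v ∧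
      ∃ f ∈ assignments w, ∃ r : Fin m → ℝ, (∀ i, 0 < r i) ∧ StrictlySeparates p f r :=
  ⟨fun h => h.positivelySpanning_and_exists, fun ⟨hp, _, hf, _, hr, h⟩ =>
    hasPolytopeSolution_of_strictlySeparates hn hw hp hf hr h⟩

end Solutions

/-! ### The weak Aleksandrov relation as Hall's condition -/

section Hall

variable {n m : ℕ} {w : Fin m → ℕ}

theorem mu_univ (p : ProblemSpace n w) : p.mu univ = ((∑ i, w i : ℕ) : ℝ≥0∞) := by
  classical
  simp [ProblemSpace.mu, discreteMeasure_apply]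

theorem lam_univ (p : ProblemSpace n w) : p.lam univ = ((∑ i, w i : ℕ) : ℝ≥0∞) := by
  classical
  simp [ProblemSpace.lam, discreteMeasure_apply]

/-- If `v (f j)` lies in `ω`, then `u j` is not in the polar set, so `μ ω` and `λ (polarSet ω)`
count disjoint sets of indices `j`. -/
theorem weakAleksandrovRelated_of_inner_pos {p : ProblemSpace n w}
    {f : Fin (∑ i, w i) → Fin m} (hf : f ∈ assignments w)
    (hpos : ∀ j, 0 < inner ℝ (p.u j : E n) (p.v (f j) : E n)) :
    WeakAleksandrovRelated p.mu p.lam := by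
  classical
  refine ⟨by rw [mu_univ, lam_univ], fun ω _ _ => ?_⟩
  rw [mu_univ, ProblemSpace.mu, ProblemSpace.lam, discreteMeasure_apply, discreteMeasure_apply,
    ← Nat.cast_add, Nat.cast_le]
  have h := sum_eq_card_filter hf (p.v ⁻¹' ω)
  simp only [mem_preimage] at h
  rw [h, Finset.sum_const, smul_eq_mul, mul_one, ← Finset.card_union_of_disjoint]
  · exact (Finset.card_le_univ _).trans (by simp)
  · refine Finset.disjoint_filter.2 fun j _ hj hj' => ?_
    simp only [polarSet, mem_iInter] at hj'
    have := hj' _ hj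
    rw [mem_ofPred_eq, real_inner_comm] at this
    exact absurd this (hpos j).not_ge

theorem cone_inter_subset {J : Set (E n)} :
    cone {v : Sph n | ∀ z ∈ J, inner ℝ z (v : E n) ≤ 0} ⊆ {x | ∀ z ∈ J, inner ℝ z x ≤ 0} := by
  rintro _ ⟨t, ht, v, hv, rfl⟩ z hz
  rw [inner_smul_right]
  exact mul_nonpos_of_nonneg_of_nonpos ht (hv z hz)

/-- A nonempty intersection of closed hemispheres is spherically convex. -/
theorem sphericallyConvex_inter {J : Set (E n)} (hJ : ∃ z ∈ J, z ≠ 0) (v₀ : Sph n)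
    (hv₀ : ∀ z ∈ J, inner ℝ z (v₀ : E n) ≤ 0) :
    SphericallyConvex {v : Sph n | ∀ z ∈ J, inner ℝ z (v : E n) ≤ 0} := by
  have heq : cone {v : Sph n | ∀ z ∈ J, inner ℝ z (v : E n) ≤ 0} =
      {x | ∀ z ∈ J, inner ℝ z x ≤ 0} := by
    refine Subset.antisymm cone_inter_subset fun x hx => ?_
    rcases eq_or_ne x 0 with rfl | h0
    · exact ⟨0, le_rfl, v₀, hv₀, by simp⟩
    · have hx0 := norm_pos_iff.2 h0
      refine ⟨‖x‖, hx0.le, ⟨‖x‖⁻¹ • x, by simp [norm_smul, hx0.ne']⟩, fun z hz => ?_, ?_⟩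
      · rw [inner_smul_right]
        exact mul_nonpos_of_nonneg_of_nonpos (inv_nonneg.2 hx0.le) (hx z hz)
      · rw [smul_smul, mul_inv_cancel₀ hx0.ne', one_smul]
  rw [SphericallyConvex, heq]
  refine ⟨⟨0, fun z _ => by simp⟩, ?_, fun hu => ?_⟩
  · intro x hx y hy a b ha hb _ z hz
    rw [inner_add_right, inner_smul_right, inner_smul_right]
    nlinarith [hx z hz, hy z hz]
  · obtain ⟨z, hz, hz0⟩ := hJ
    have := (hu ▸ mem_univ z : z ∈ {x : E n | ∀ z ∈ J, inner ℝ z x ≤ 0}) z hz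
    exact absurd this (real_inner_self_pos.2 hz0).not_ge

/-- Hall's theorem applied to `w i` copies of each `v i`, a copy being compatible with `u j` when `u
j · v i > 0`. To check Hall's condition for a set `I` of indices, the relation is tested on the
intersection of the hemispheres polar to those `u j` that are incompatible with all of `I`. -/
theorem WeakAleksandrovRelated.exists_inner_pos {p : ProblemSpace n w}
    (h : WeakAleksandrovRelated p.mu p.lam) :
    ∃ f ∈ assignments w, ∀ j, 0 < inner ℝ (p.u j : E n) (p.v (f j) : E n) := by
  classical
  have hhall : ∀ I : Finset (Fin m),
      ∑ i ∈ I, w i + (Finset.univ.filter fun j => ∀ i ∈ I,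
        inner ℝ (p.u j : E n) (p.v i : E n) ≤ 0).card ≤ ∑ i, w i := fun I => by
    set J := Finset.univ.filter fun j => ∀ i ∈ I, inner ℝ (p.u j : E n) (p.v i : E n) ≤ 0 with hJ
    rcases I.eq_empty_or_nonempty with rfl | ⟨i₀, hi₀⟩
    · simpa using Finset.card_le_univ J
    -- With no hemispheres to intersect, `ω` would be the whole sphere, which is not spherically
    -- convex.
    rcases J.eq_empty_or_nonempty with hJ0 | ⟨j₀, hj₀⟩
    · rw [hJ0, Finset.card_empty, add_zero]
      exact Finset.sum_le_univ_sum_of_nonneg fun _ => Nat.zero_le _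
    have hJv : ∀ j ∈ J, ∀ i ∈ I, inner ℝ (p.u j : E n) (p.v i : E n) ≤ 0 := fun j hj =>
      (Finset.mem_filter.1 hj).2
    set ω : Set (Sph n) := {v | ∀ z ∈ (fun j => (p.u j : E n)) '' J, inner ℝ z (v : E n) ≤ 0}
      with hω
    have hIω : ∀ i ∈ I, p.v i ∈ ω := fun i hi => by
      rintro _ ⟨j, hj, rfl⟩
      exact hJv j hj i hi
    have hconv : SphericallyConvex ω :=
      sphericallyConvex_inter ⟨_, mem_image_of_mem _ hj₀, by
        rw [← norm_pos_iff, norm_coe_sph]; exact one_pos⟩ (p.v i₀) (hIω i₀ hi₀)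
    have hcl : IsCompact ω := by
      refine IsClosed.isCompact ?_
      simp only [hω, ofPred_forall]
      exact isClosed_biInter fun z _ => isClosed_le (by fun_prop) continuous_const
    have := h.2 ω hcl hconv
    rw [mu_univ, ProblemSpace.mu, ProblemSpace.lam, discreteMeasure_apply, discreteMeasure_apply,
      ← Nat.cast_add, Nat.cast_le, Finset.sum_const, smul_eq_mul, mul_one] at this
    refine le_trans (add_le_add ?_ ?_) this
    · exact Finset.sum_le_sum_of_subset fun i hi => by simpa using hIω i hi
    · refine Finset.card_le_card fun j hj => ?_
      simp only [Finset.mem_filter, Finset.mem_univ, true_and, polarSet, mem_iInter]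
      intro v hv
      rw [mem_ofPred_eq, real_inner_comm]
      exact hv _ (mem_image_of_mem _ hj)
  obtain ⟨e, he, het⟩ := (Finset.all_card_le_biUnion_card_iff_exists_injective
    (fun s : (i : Fin m) × Fin (w i) => Finset.univ.filter fun j =>
      0 < inner ℝ (p.u j : E n) (p.v s.1 : E n))).1 (fun T => by
    have h1 : T.card ≤ ∑ i ∈ T.image Sigma.fst, w i := by
      calc T.card ≤ ((T.image Sigma.fst).sigma fun i => (Finset.univ : Finset (Fin (w i)))).card :=
            Finset.card_le_card fun s hs => by
              simpa using ⟨s.2, hs⟩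
        _ = _ := by simp
    have h2 := hhall (T.image Sigma.fst)
    set A := T.biUnion fun s => Finset.univ.filter fun j =>
      0 < inner ℝ (p.u j : E n) (p.v s.1 : E n) with hA
    have h3 : Aᶜ ⊆ Finset.univ.filter fun j => ∀ i ∈ T.image Sigma.fst,
        inner ℝ (p.u j : E n) (p.v i : E n) ≤ 0 := fun j hj => by
      simp only [hA, Finset.mem_compl, Finset.mem_biUnion, Finset.mem_filter, Finset.mem_univ,
        true_and, not_exists, not_and, not_lt] at hj ⊢
      intro i hi
      obtain ⟨s, hs, rfl⟩ := Finset.mem_image.1 hi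
      exact hj s hs
    have h4 := Finset.card_le_card h3
    have h5 := Finset.card_add_card_compl A
    rw [Fintype.card_fin] at h5
    omega)
  -- There are as many copies as directions `u j`, so the matching is a bijection and its inverse
  -- yields the assignment.
  have hbij : Function.Bijective e :=
    (Fintype.bijective_iff_injective_and_card e).2 ⟨he, by simp⟩
  set q := Equiv.ofBijective e hbij
  refine ⟨fun j => (q.symm j).1, fun i => ?_, fun j => ?_⟩
  · have : (Finset.univ.filter fun j => (q.symm j).1 = i) =
        (Finset.univ : Finset (Fin (w i))).map
          ((Function.Embedding.sigmaMk i).trans q.toEmbedding) := by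
      ext j
      simp only [Finset.mem_filter, Finset.mem_univ, true_and, Finset.mem_map,
        Function.Embedding.trans_apply, Equiv.coe_toEmbedding, Function.Embedding.sigmaMk_apply]
      constructor
      · rintro rfl
        exact ⟨(q.symm j).2, q.apply_symm_apply j⟩
      · rintro ⟨a, rfl⟩
        simp
    rw [this]
    simp
  · have := het (q.symm j)
    rw [show e (q.symm j) = j from q.apply_symm_apply j] at this
    exact (Finset.mem_filter.1 this).2

theorem mem_admissibleSet_iff (hw : ∀ i, 0 < w i) (p : ProblemSpace n w) :
    p ∈ admissibleSet n w ↔ PositivelySpanning p.v ∧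
      ∃ f ∈ assignments w, ∀ j, 0 < inner ℝ (p.u j : E n) (p.v (f j) : E n) := by
  rw [admissibleSet, mem_ofPred_eq, and_comm, ProblemSpace.mu, not_concentrated_iff hw]
  exact and_congr_right fun _ => ⟨fun h => h.exists_inner_pos, fun ⟨_, hf, h⟩ =>
    weakAleksandrovRelated_of_inner_pos hf h⟩

end Hall

/-! ### The assignment functional and its maximizers -/

section Functional

variable {n m : ℕ} {w : Fin m → ℕ}

/-- The positive part of `u j · v l`. -/
noncomputable def posInner (p : ProblemSpace n w) (j : Fin (∑ i, w i)) (l : Fin m) : ℝ :=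
  max (inner ℝ (p.u j : E n) (p.v l : E n)) 0

theorem posInner_nonneg (p : ProblemSpace n w) (j : Fin (∑ i, w i)) (l : Fin m) :
    0 ≤ posInner p j l := le_max_right _ _

theorem posInner_pos_iff {p : ProblemSpace n w} {j : Fin (∑ i, w i)} {l : Fin m} :
    0 < posInner p j l ↔ 0 < inner ℝ (p.u j : E n) (p.v l : E n) := by
  simp [posInner]

theorem sum_ennreal_log {ι : Type*} (s : Finset ι) (a : ι → ℝ≥0∞) :
    ∑ j ∈ s, ENNReal.log (a j) = ENNReal.log (∏ j ∈ s, a j) := by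
  classical
  induction s using Finset.induction_on with
  | empty => simp
  | insert j s hj ih => rw [Finset.sum_insert hj, Finset.prod_insert hj, ENNReal.log_mul_add, ih]

/-- Truncating at zero turns the value `-∞` into a vanishing product, so `A` can be compared through
real products of nonnegative entries. -/
theorem assignmentFunctional_eq (p : ProblemSpace n w) (f : Fin (∑ i, w i) → Fin m) :
    assignmentFunctional p f = ENNReal.log (ENNReal.ofReal (∏ j, posInner p j (f j))) := by
  rw [ENNReal.ofReal_prod_of_nonneg fun j _ => posInner_nonneg p j (f j), ← sum_ennreal_log]
  refine Finset.sum_congr rfl fun j _ => ?_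
  rw [posInner, ENNReal.ofReal_max, ENNReal.ofReal_zero, max_eq_left zero_le]

theorem bot_lt_assignmentFunctional_iff {p : ProblemSpace n w} {f : Fin (∑ i, w i) → Fin m} :
    ⊥ < assignmentFunctional p f ↔ ∀ j, 0 < inner ℝ (p.u j : E n) (p.v (f j) : E n) := by
  rw [assignmentFunctional_eq, ENNReal.bot_lt_log_iff, ENNReal.ofReal_pos]
  simp only [← posInner_pos_iff]
  constructor
  · intro h j
    refine (posInner_nonneg p j (f j)).lt_of_ne' fun h0 => h.ne' ?_
    exact Finset.prod_eq_zero (Finset.mem_univ j) h0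
  · exact fun h => Finset.prod_pos fun j _ => h j

theorem comp_perm_mem_assignments {f : Fin (∑ i, w i) → Fin m} (hf : f ∈ assignments w)
    (σ : Equiv.Perm (Fin (∑ i, w i))) : f ∘ σ ∈ assignments w := fun i => by
  rw [← hf i]
  refine Finset.card_equiv σ fun j => ?_
  simp

theorem mem_uniquelyMaximizedSet_iff (hw : ∀ i, 0 < w i) {p : ProblemSpace n w}
    (hp : PositivelySpanning p.v) : UniquelyMaximized p ↔
      ∃ f ∈ assignments w, ∃ r : Fin m → ℝ, (∀ i, 0 < r i) ∧ StrictlySeparates p f r := by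
  constructor
  · rintro ⟨f, hf, hbot, hmax⟩
    rw [bot_lt_assignmentFunctional_iff] at hbot
    obtain ⟨r, hr, h⟩ := exists_strict_prices (posInner p) (posInner_nonneg p) f
      (surjective_of_mem_assignments hw hf) (fun j => posInner_pos_iff.2 (hbot j)) fun σ hσ => by
        have := hmax _ (comp_perm_mem_assignments hf σ) hσ
        rw [assignmentFunctional_eq, assignmentFunctional_eq, ENNReal.log_lt_log_iff] at this
        exact (ENNReal.ofReal_lt_ofReal_iff'.1 this).1
    refine ⟨f, hf, r, hr, fun j l hl => lt_of_le_of_lt ?_ (lt_of_lt_of_eq (h j l hl) ?_)⟩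
    · exact mul_le_mul_of_nonneg_left (le_max_left _ _) (hr l).le
    · rw [posInner, max_eq_left (hbot j).le]
  · rintro ⟨f, hf, r, hr, h⟩
    have hpos := h.inner_pos hr hp
    refine ⟨f, hf, bot_lt_assignmentFunctional_iff.2 hpos, fun g hg hgf => ?_⟩
    rw [assignmentFunctional_eq, assignmentFunctional_eq, ENNReal.log_lt_log_iff]
    refine (ENNReal.ofReal_lt_ofReal_iff
      (Finset.prod_pos fun j _ => posInner_pos_iff.2 (hpos j))).2 ?_
    refine prod_lt_prod_of_strict_prices (posInner p) (posInner_nonneg p) f g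
      (fun i => by rw [hf i, hg i]) hgf (fun j => posInner_pos_iff.2 (hpos j)) r hr
      fun j l hl => ?_
    rw [posInner, posInner, max_eq_left (hpos j).le, mul_max_of_nonneg _ _ (hr l).le, mul_zero]
    exact max_lt (h j l hl) (mul_pos (hr _) (hpos j))

theorem exists_weak_prices (hw : ∀ i, 0 < w i) {p : ProblemSpace n w}
    (hp : ∃ f ∈ assignments w, ∀ j, 0 < inner ℝ (p.u j : E n) (p.v (f j) : E n)) :
    ∃ f ∈ assignments w, (∀ j, 0 < inner ℝ (p.u j : E n) (p.v (f j) : E n)) ∧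
      ∃ r : Fin m → ℝ, (∀ i, 0 < r i) ∧ ∀ j l, r l * inner ℝ (p.u j : E n) (p.v l : E n) ≤
        r (f j) * inner ℝ (p.u j : E n) (p.v (f j) : E n) := by
  obtain ⟨g, hg, hgpos⟩ := hp
  obtain ⟨f, hf, hmax⟩ := Set.exists_max_image (assignments w)
    (fun f => ∏ j, posInner p j (f j)) (Set.toFinite _) ⟨g, hg⟩
  have hfpos : ∀ j, 0 < inner ℝ (p.u j : E n) (p.v (f j) : E n) := by
    rw [← bot_lt_assignmentFunctional_iff]
    refine (bot_lt_assignmentFunctional_iff.2 hgpos).trans_le ?_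
    rw [assignmentFunctional_eq, assignmentFunctional_eq, ENNReal.log_le_log_iff]
    exact ENNReal.ofReal_le_ofReal (hmax g hg)
  obtain ⟨r, hr, h⟩ := exists_prices (posInner p) (posInner_nonneg p) f
    (surjective_of_mem_assignments hw hf) (fun j => posInner_pos_iff.2 (hfpos j)) fun σ =>
      hmax _ (comp_perm_mem_assignments hf σ)
  refine ⟨f, hf, hfpos, r, hr, fun j l => ?_⟩
  refine (mul_le_mul_of_nonneg_left (le_max_left _ _) (hr l).le).trans ((h j l).trans_eq ?_)
  rw [posInner, max_eq_left (hfpos j).le]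

end Functional

/-! ### Openness, and density by perturbation -/

section Topological

variable {n m : ℕ} {w : Fin m → ℕ}

theorem ProblemSpace.continuous_v : Continuous (ProblemSpace.v : ProblemSpace n w → _) :=
  continuous_fst.comp continuous_subtype_val

theorem ProblemSpace.continuous_u : Continuous (ProblemSpace.u : ProblemSpace n w → _) :=
  continuous_snd.comp continuous_subtype_val

theorem continuous_inner_u_v (j : Fin (∑ i, w i)) (l : Fin m) :
    Continuous fun p : ProblemSpace n w => inner ℝ (p.u j : E n) (p.v l : E n) := by
  have hu : Continuous fun p : ProblemSpace n w => p.u j :=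
    (continuous_apply j).comp ProblemSpace.continuous_u
  have hv : Continuous fun p : ProblemSpace n w => p.v l :=
    (continuous_apply l).comp ProblemSpace.continuous_v
  fun_prop

theorem isOpen_spanning : IsOpen {p : ProblemSpace n w | PositivelySpanning p.v} :=
  isOpen_positivelySpanning.preimage ProblemSpace.continuous_v

theorem isOpen_admissibleSet (hw : ∀ i, 0 < w i) : IsOpen (admissibleSet n w) := by
  have : admissibleSet n w = {p | PositivelySpanning p.v} ∩ ⋃ f ∈ assignments w,
      ⋂ j, {p | 0 < inner ℝ (p.u j : E n) (p.v (f j) : E n)} := by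
    ext p
    simp [mem_admissibleSet_iff hw]
  rw [this]
  exact isOpen_spanning.inter (isOpen_biUnion fun f _ => isOpen_iInter_of_finite fun j =>
    isOpen_lt continuous_const (continuous_inner_u_v _ _))

theorem isOpen_strictlySeparates (f : Fin (∑ i, w i) → Fin m) (r : Fin m → ℝ) :
    IsOpen {p : ProblemSpace n w | StrictlySeparates p f r} := by
  simp only [StrictlySeparates, ofPred_forall]
  refine isOpen_iInter_of_finite fun j => isOpen_iInter_of_finite fun l =>
    isOpen_iInter_of_finite fun _ => isOpen_lt ?_ ?_
  · exact continuous_const.mul (continuous_inner_u_v _ _)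
  · exact continuous_const.mul (continuous_inner_u_v _ _)

theorem isOpen_solvableSet (hn : 1 ≤ n) (hw : ∀ i, 0 < w i) : IsOpen (solvableSet n w) := by
  have : solvableSet n w = {p | PositivelySpanning p.v} ∩ ⋃ f ∈ assignments w,
      ⋃ r ∈ {r : Fin m → ℝ | ∀ i, 0 < r i}, {p | StrictlySeparates p f r} := by
    ext p
    simp [solvableSet, hasPolytopeSolution_iff hn hw]
  rw [this]
  exact isOpen_spanning.inter (isOpen_biUnion fun f _ => isOpen_biUnion fun r _ =>
    isOpen_strictlySeparates f r)

theorem solvableSet_subset_admissibleSet (hw : ∀ i, 0 < w i) :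
    solvableSet n w ⊆ admissibleSet n w := fun p hp => by
  obtain ⟨hs, f, hf, r, hr, h⟩ := HasPolytopeSolution.positivelySpanning_and_exists hp
  exact (mem_admissibleSet_iff hw p).2 ⟨hs, f, hf, h.inner_pos hr hs⟩

theorem admissibleSet_inter_uniquelyMaximizedSet (hn : 1 ≤ n) (hw : ∀ i, 0 < w i) :
    admissibleSet n w ∩ uniquelyMaximizedSet n w = solvableSet n w := by
  ext p
  rw [mem_inter_iff, uniquelyMaximizedSet, solvableSet, mem_ofPred_eq, mem_ofPred_eq]
  constructor
  · rintro ⟨hp, hu⟩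
    have hs := ((mem_admissibleSet_iff hw p).1 hp).1
    exact (hasPolytopeSolution_iff hn hw p).2 ⟨hs, (mem_uniquelyMaximizedSet_iff hw hs).1 hu⟩
  · intro hp
    obtain ⟨hs, h⟩ := (hasPolytopeSolution_iff hn hw p).1 hp
    exact ⟨solvableSet_subset_admissibleSet hw hp, (mem_uniquelyMaximizedSet_iff hw hs).2 h⟩

open Classical in
/-- The normalization of a vector, with a default value for the zero vector. -/
noncomputable def normalizeOr (d : Sph n) (z : E n) : Sph n :=
  if h : z = 0 then d else ⟨‖z‖⁻¹ • z, by simp [norm_smul, h]⟩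

theorem coe_normalizeOr (d : Sph n) {z : E n} (hz : z ≠ 0) :
    (normalizeOr d z : E n) = ‖z‖⁻¹ • z := by
  simp [normalizeOr, hz]

theorem normalizeOr_coe (d : Sph n) : normalizeOr d (d : E n) = d := by
  have h0 : (d : E n) ≠ 0 := by rw [← norm_pos_iff, norm_coe_sph]; exact one_pos
  exact Subtype.ext (by rw [coe_normalizeOr d h0, norm_coe_sph, inv_one, one_smul])

theorem continuousAt_normalizeOr (d : Sph n) {z : E n} (hz : z ≠ 0) :
    ContinuousAt (normalizeOr d) z := by
  rw [ContinuousAt, tendsto_subtype_rng, coe_normalizeOr d hz]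
  have hc : ContinuousAt (fun z : E n => ‖z‖⁻¹ • z) z :=
    (continuous_norm.continuousAt.inv₀ (norm_ne_zero_iff.2 hz)).smul continuousAt_id
  refine Filter.Tendsto.congr' ?_ hc
  filter_upwards [isOpen_ne.mem_nhds hz] with y hy
  exact (coe_normalizeOr d hy).symm

/-- If `a < h`, continuity suffices. If `a = h`, the difference of the two sides is `h ε / 2` times
`qf + ql - 2 G + ε (G ql - qf ^ 2)`, whose value at `ε = 0` is positive. -/
theorem eventually_perturbed_lt {h a G qf ql : ℝ} (hh : 0 < h) (ha : a ≤ h)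
    (hG : a = h → 2 * G < qf + ql) :
    ∀ᶠ ε in 𝓝[>] (0 : ℝ), (a + ε * (h * G)) * (1 - ε * ql / 2) <
      (h + ε * (h * qf)) * (1 - ε * qf / 2) := by
  rcases ha.lt_or_eq with hlt | rfl
  · have h1 : Continuous fun ε : ℝ => (a + ε * (h * G)) * (1 - ε * ql / 2) := by fun_prop
    have h2 : Continuous fun ε : ℝ => (h + ε * (h * qf)) * (1 - ε * qf / 2) := by fun_prop
    exact (h1.continuousAt.eventually_lt h2.continuousAt (by simpa using hlt)).filter_mono
      nhdsWithin_le_nhds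
  · have h1 : Continuous fun ε : ℝ => qf + ql - 2 * G + ε * (G * ql - qf ^ 2) := by fun_prop
    have h2 : ∀ᶠ ε in 𝓝[>] (0 : ℝ), 0 < qf + ql - 2 * G + ε * (G * ql - qf ^ 2) :=
      (continuousAt_const.eventually_lt h1.continuousAt (by simpa using hG rfl)).filter_mono
        nhdsWithin_le_nhds
    filter_upwards [h2, self_mem_nhdsWithin] with ε hε (hε0 : 0 < ε)
    have := mul_pos (mul_pos hh hε0) hε
    linarith

/-- Weak prices become strict after a small perturbation of the directions `u j` towards
`v (f j)` and a suitable change of the prices. -/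
theorem eventually_strict_prices {v : Fin m → Sph n} {u : Fin (∑ i, w i) → Sph n}
    (hv : Function.Injective v) {f : Fin (∑ i, w i) → Fin m}
    (hpos : ∀ j, 0 < inner ℝ (u j : E n) (v (f j) : E n)) {r : Fin m → ℝ} (hr : ∀ i, 0 < r i)
    (h : ∀ j l, r l * inner ℝ (u j : E n) (v l : E n) ≤
      r (f j) * inner ℝ (u j : E n) (v (f j) : E n)) :
    ∃ c : Fin (∑ i, w i) → ℝ, ∀ᶠ ε in 𝓝[>] (0 : ℝ), ∃ s : Fin m → ℝ, (∀ i, 0 < s i) ∧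
      ∀ j l, l ≠ f j →
        s l * inner ℝ ((u j : E n) + ε • c j • (v (f j) : E n)) (v l : E n) <
        s (f j) * inner ℝ ((u j : E n) + ε • c j • (v (f j) : E n)) (v (f j) : E n) := by
  set q : Fin m → ℝ := fun i => r i ^ 2 with hq
  set G : Fin m → Fin m → ℝ := fun i l => r i * r l * inner ℝ (v i : E n) (v l : E n) with hGdef
  set a : Fin (∑ i, w i) → Fin m → ℝ := fun j l => r l * inner ℝ (u j : E n) (v l : E n) with ha
  -- With `x i = r i • v i`, this says that `‖x i - x l‖ ^ 2 > 0`.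
  have hG : ∀ i l, l ≠ i → 2 * G i l < q i + q l := fun i l hl => by
    have hne : r i • (v i : E n) - r l • (v l : E n) ≠ 0 := fun h0 =>
      hl (hv (eq_of_smul_eq_smul (hr i).le (hr l) (sub_eq_zero.1 h0))).symm
    have hn := pow_pos (norm_pos_iff.2 hne) 2
    rw [norm_sub_sq_real, norm_smul, norm_smul, norm_coe_sph, norm_coe_sph, real_inner_smul_left,
      inner_smul_right, mul_one, mul_one, Real.norm_of_nonneg (hr i).le,
      Real.norm_of_nonneg (hr l).le] at hn
    simp only [hGdef, hq]
    linarith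
  have hGq : ∀ i, G i i = q i := fun i => by
    simp only [hGdef, hq]
    rw [real_inner_self_eq_norm_sq, norm_coe_sph]
    ring
  -- The shift of `u j` is `ε` times `x (f j)`, scaled by the maximal value `a j (f j)`, so that a
  -- tied comparison has this value as a common factor.
  refine ⟨fun j => a j (f j) * r (f j), ?_⟩
  have h1 : ∀ᶠ ε in 𝓝[>] (0 : ℝ), ∀ j l, l ≠ f j →
      (a j l + ε * (a j (f j) * G (f j) l)) * (1 - ε * q l / 2) <
        (a j (f j) + ε * (a j (f j) * q (f j))) * (1 - ε * q (f j) / 2) := by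
    refine Filter.eventually_all.2 fun j => Filter.eventually_all.2 fun l => ?_
    by_cases hl : l = f j
    · exact Filter.Eventually.of_forall fun _ h => absurd hl h
    · filter_upwards [eventually_perturbed_lt (mul_pos (hr (f j)) (hpos j)) (h j l)
        fun _ => hG (f j) l hl] with ε hε _ using hε
  have h2 : ∀ᶠ ε in 𝓝[>] (0 : ℝ), ∀ i, 0 < 1 - ε * q i / 2 := by
    refine Filter.eventually_all.2 fun i => ?_
    have hc : Continuous fun ε : ℝ => 1 - ε * q i / 2 := by fun_prop
    exact (continuousAt_const.eventually_lt hc.continuousAt (by simp)).filter_mono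
      nhdsWithin_le_nhds
  filter_upwards [h1, h2] with ε h1 h2
  -- Shrinking `x i` by the factor `1 - ε ‖x i‖ ^ 2 / 2` makes the first-order gap at a tie
  -- proportional to `‖x (f j) - x l‖ ^ 2`.
  refine ⟨fun i => r i * (1 - ε * q i / 2), fun i => mul_pos (hr i) (h2 i), fun j l hl => ?_⟩
  have key : ∀ i, r i * (1 - ε * q i / 2) *
      inner ℝ ((u j : E n) + ε • (a j (f j) * r (f j)) • (v (f j) : E n)) (v i : E n) =
      (a j i + ε * (a j (f j) * G (f j) i)) * (1 - ε * q i / 2) := fun i => by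
    rw [inner_add_left, real_inner_smul_left, real_inner_smul_left]
    simp only [ha, hGdef]
    ring
  rw [key, key, hGq]
  exact h1 j l hl

theorem admissibleSet_subset_closure_solvableSet (hn : 1 ≤ n) (hw : ∀ i, 0 < w i) :
    admissibleSet n w ⊆ closure (solvableSet n w) := fun p hp => by
  classical
  obtain ⟨hs, hp⟩ := (mem_admissibleSet_iff hw p).1 hp
  obtain ⟨f, hf, hpos, r, hr, h⟩ := exists_weak_prices hw hp
  obtain ⟨c, hc⟩ := eventually_strict_prices p.2.1 hpos hr h
  set z : ℝ → Fin (∑ i, w i) → E n := fun ε j =>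
    (p.u j : E n) + ε • c j • (p.v (f j) : E n) with hz
  have hzc : ∀ j, Continuous fun ε => z ε j := fun j => by fun_prop
  have hz0 : ∀ j, z 0 j = p.u j := fun j => by simp [hz]
  have hu0 : ∀ j, z 0 j ≠ 0 := fun j => by
    rw [hz0, ← norm_pos_iff, norm_coe_sph]; exact one_pos
  have hU : Filter.Tendsto (fun ε j => normalizeOr (p.u j) (z ε j)) (𝓝 0) (𝓝 p.u) := by
    refine tendsto_pi_nhds.2 fun j => ?_
    have := (continuousAt_normalizeOr (p.u j) (hu0 j)).tendsto.comp (hzc j).continuousAt.tendsto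
    rwa [hz0, normalizeOr_coe] at this
  have hinj : ∀ᶠ ε in 𝓝 (0 : ℝ),
      Function.Injective fun j => normalizeOr (p.u j) (z ε j) := by
    have : ∀ᶠ ε in 𝓝 (0 : ℝ), ∀ i j, i ≠ j →
        normalizeOr (p.u i) (z ε i) ≠ normalizeOr (p.u j) (z ε j) := by
      refine Filter.eventually_all.2 fun i => Filter.eventually_all.2 fun j => ?_
      by_cases hij : i = j
      · exact Filter.Eventually.of_forall fun _ h => absurd hij h
      · have hopen : IsOpen {u : Fin (∑ i, w i) → Sph n | u i ≠ u j} :=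
          isOpen_ne_fun (continuous_apply i) (continuous_apply j)
        filter_upwards [hU.eventually (hopen.eventually_mem (x := p.u) (p.2.2.ne hij))]
          with ε hε _ using hε
    filter_upwards [this] with ε hε i j hij
    by_contra hne
    exact hε i j hne hij
  -- The `v i` stay fixed. The default value `p` is never taken for `ε` near `0`, where the
  -- perturbed directions remain distinct.
  set P : ℝ → ProblemSpace n w := fun ε =>
    if hi : Function.Injective fun j => normalizeOr (p.u j) (z ε j) then
      ⟨(p.v, fun j => normalizeOr (p.u j) (z ε j)), p.2.1, hi⟩ else p with hP
  have hPt : Filter.Tendsto P (𝓝 0) (𝓝 p) := by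
    rw [tendsto_subtype_rng]
    refine Filter.Tendsto.congr' ?_ (tendsto_const_nhds.prodMk_nhds hU : Filter.Tendsto
      (fun ε => (p.v, fun j => normalizeOr (p.u j) (z ε j))) (𝓝 0) (𝓝 (p.v, p.u)))
    filter_upwards [hinj] with ε hε
    simp only [hP, dif_pos hε]
  have hzne : ∀ᶠ ε in 𝓝 (0 : ℝ), ∀ j, z ε j ≠ 0 :=
    Filter.eventually_all.2 fun j => (hzc j).continuousAt.eventually_ne (hu0 j)
  refine mem_closure_of_tendsto (hPt.mono_left (nhdsWithin_le_nhds (s := Ioi 0))) ?_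
  filter_upwards [hc, hinj.filter_mono nhdsWithin_le_nhds, hzne.filter_mono nhdsWithin_le_nhds]
    with ε ⟨s, hs0, hs1⟩ hε hzε
  have hPε : P ε = ⟨(p.v, fun j => normalizeOr (p.u j) (z ε j)), p.2.1, hε⟩ := dif_pos hε
  rw [hPε]
  refine (hasPolytopeSolution_iff hn hw _).2 ⟨hs, f, hf, s, hs0, fun j l hl => ?_⟩
  change s l * inner ℝ (normalizeOr (p.u j) (z ε j) : E n) (p.v l : E n) <
    s (f j) * inner ℝ (normalizeOr (p.u j) (z ε j) : E n) (p.v (f j) : E n)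
  -- Normalizing the perturbed direction multiplies both sides by the same positive factor.
  rw [coe_normalizeOr _ (hzε j), real_inner_smul_left, real_inner_smul_left, mul_left_comm,
    mul_left_comm (s (f j))]
  exact mul_lt_mul_of_pos_left (hs1 j l hl) (inv_pos.2 (norm_pos_iff.2 (hzε j)))

end Topological

end DiscreteGaussImage

theorem mainTheorem4 (n : ℕ) (hn : 1 ≤ n) (m : ℕ) (w : Fin m → ℕ) (hw : ∀ i, 0 < w i) :
    IsOpen (DiscreteGaussImage.admissibleSet n w) ∧
    (DiscreteGaussImage.solvableSet n w ⊆ DiscreteGaussImage.admissibleSet n w ∧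
      IsOpen (DiscreteGaussImage.solvableSet n w) ∧
      DiscreteGaussImage.admissibleSet n w ⊆ closure (DiscreteGaussImage.solvableSet n w)) ∧
    (IsOpen (DiscreteGaussImage.admissibleSet n w ∩
        DiscreteGaussImage.uniquelyMaximizedSet n w) ∧
      DiscreteGaussImage.admissibleSet n w ⊆
        closure (DiscreteGaussImage.admissibleSet n w ∩
          DiscreteGaussImage.uniquelyMaximizedSet n w)) := by
  rw [DiscreteGaussImage.admissibleSet_inter_uniquelyMaximizedSet hn hw]
  have hopen := DiscreteGaussImage.isOpen_solvableSet (n := n) hn hw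
  have hdense := DiscreteGaussImage.admissibleSet_subset_closure_solvableSet (n := n) hn hw
  exact ⟨DiscreteGaussImage.isOpen_admissibleSet hw,
    ⟨DiscreteGaussImage.solvableSet_subset_admissibleSet hw, hopen, hdense⟩, hopen, hdense⟩
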